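/- A digraph $G$ consists of finite sets $V(G)$ of vertices and $E(G)$ of edges, each edge having a source and a target, with at most one edge from $v$ to $w$ for any two distinct vertices $v,w$, and with any number of loops allowed at each vertex. A coherently oriented cycle of $G$ is a sequence of $n\ge 1$ edges $e_1,\dots,e_n$ with distinct sources such that the target of $e_i$ is the source of $e_{i+1}$ (indices modulo $n$); for $n=1$ it is a loop. A digraph $G$ is an MP-digraph if (1) neither $G$ nor the digraph obtained from $G$ by reversing all edges contains as a (not necessarily induced) subgraph, on distinct vertices, the digraph with edges $(v_1,v_0),(v_0,v_2),(v_1,v_2)$ or the digraph with edges $(v_0,v_1),(v_2,v_1),(v_2,v_3)$; and (2) every coherently oriented cycle of $G$ that is not a loop is a connected component of $G$. A multipath of $G$ is a spanning subgraph each of whose connected components is a single vertex or a simple directed path. For an MP-digraph $G$, the edge sets of the multipaths are the independent sets of a matroid $M_G$ on $E(G)$, the multipath matroid; write $r(G)$ for its rank, and $$T_{M}(x,y)=\sum_{A\subseteq E}(x-1)^{r_M(E)-r_M(A)}(y-1)^{|A|-r_M(A)}$$ for the Tutte polynomial of a matroid $M$ on a finite set $E$. A flowing $k$-colouring of a digraph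 $S$ is a map $c\colon V(S)\to\{1,\dots,k\}$ such that $c(v)\ne c(w)$ for every edge $(v,w)$, $c(v)=c(v')$ whenever $(v,w)$ and $(v',w)$ are edges, and $c(v)=c(v')$ whenever $(w,v)$ and $(w,v')$ are edges; $\tau_S(k)$ is the number of flowing $k$-colourings of $S$. A spanning forest of $G$ is a spanning subgraph whose part in each connected component of $G$ is a spanning tree of that component (as an undirected graph). Theorem. Let $G$ be an MP-digraph with no coherently oriented cycles (in particular without loops), and let $S$ be a spanning forest of $G$ of maximal rank, that is, with $r(S)=r(G)$. Then, for every integer $k\ge 0$, $$k^{p_0(G)}\,T_{M_G}(1-k,0)=(-1)^{r(G)}\,\tau_S(k),$$ where $p_0(G)$ is the number of connected components of $G$ (and $0^0=1$). -/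

import Mathlib

/-- A directed graph with vertex set `V` and edge set `E`: every edge has a source and a target,
there is at most one edge from `v` to `w` for distinct vertices `v`, `w`, and there may be any
number of loops at each vertex. -/
structure LoopyDigraph (V E : Type*) where
  src : E → V
  tgt : E → V
  unique_edge : ∀ e f, src e ≠ tgt e → src e = src f → tgt e = tgt f → e = f

namespace LoopyDigraph

/-- The digraph with all edges reversed. -/
def reverse {V E : Type*} (G : LoopyDigraph V E) : LoopyDigraph V E where
  src := G.tgt
  tgt := G.src
  unique_edge := fun e f h h1 h2 => G.unique_edge e f h.symm h2 h1

/-- The spanning subgraph of `G` with edge set `A`. -/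
def spanning {V E : Type*} (G : LoopyDigraph V E) (A : Set E) : LoopyDigraph V A where
  src := fun e => G.src e
  tgt := fun e => G.tgt e
  unique_edge := fun e f h h1 h2 => Subtype.ext (G.unique_edge e f h h1 h2)

/-- Two distinct vertices are adjacent if some edge joins them, in either direction. The connected
components of this simple graph are (the vertex sets of) the connected components of `G`. -/
def underlying {V E : Type*} (G : LoopyDigraph V E) : SimpleGraph V where
  Adj v w := v ≠ w ∧ ∃ e, (G.src e = v ∧ G.tgt e = w) ∨ (G.src e = w ∧ G.tgt e = v)
  symm := ⟨fun _ _ h => ⟨h.1.symm, h.2.imp fun _ he => he.symm⟩⟩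
  loopless := ⟨fun _ h => h.1 rfl⟩

/-- The number of connected components, isolated vertices included. -/
noncomputable def numComponents {V E : Type*} (G : LoopyDigraph V E) : ℕ :=
  Nat.card G.underlying.ConnectedComponent

/-- The edges of `G` lying in the connected component `C` (source and target of an edge are
always in the same component). -/
def edgesOf {V E : Type*} (G : LoopyDigraph V E) (C : G.underlying.ConnectedComponent) : Set E :=
  {f | G.src f ∈ C.supp}

/-- `e 0, …, e n` is a coherently oriented cycle with `n + 1` edges and `n + 1` distinct vertices
(addition in `Fin (n + 1)` is cyclic). For `n = 0` it is a loop. -/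
def IsCoherentCycle {V E : Type*} (G : LoopyDigraph V E) {n : ℕ} (e : Fin (n + 1) → E) : Prop :=
  (∀ i, G.tgt (e i) = G.src (e (i + 1))) ∧ Function.Injective (fun i => G.src (e i))

/-- `G` has a coherently oriented cycle, loops included. -/
def HasCoherentCycle {V E : Type*} (G : LoopyDigraph V E) : Prop :=
  ∃ (n : ℕ) (e : Fin (n + 1) → E), G.IsCoherentCycle e

/-- `G` contains the triangle `v₁ → v₀ → v₂`, `v₁ → v₂` on distinct vertices. -/
def ContainsTriangle {V E : Type*} (G : LoopyDigraph V E) : Prop :=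
  ∃ (v₀ v₁ v₂ : V) (a b c : E), v₀ ≠ v₁ ∧ v₀ ≠ v₂ ∧ v₁ ≠ v₂ ∧
    (G.src a = v₁ ∧ G.tgt a = v₀) ∧ (G.src b = v₀ ∧ G.tgt b = v₂) ∧
    (G.src c = v₁ ∧ G.tgt c = v₂)

/-- `G` contains the alternating path `v₀ → v₁ ← v₂ → v₃` on distinct vertices. -/
def ContainsAlternating {V E : Type*} (G : LoopyDigraph V E) : Prop :=
  ∃ (v₀ v₁ v₂ v₃ : V) (a b c : E),
    v₀ ≠ v₁ ∧ v₀ ≠ v₂ ∧ v₀ ≠ v₃ ∧ v₁ ≠ v₂ ∧ v₁ ≠ v₃ ∧ v₂ ≠ v₃ ∧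
    (G.src a = v₀ ∧ G.tgt a = v₁) ∧ (G.src b = v₂ ∧ G.tgt b = v₁) ∧
    (G.src c = v₂ ∧ G.tgt c = v₃)

/-- An MP-digraph: up to edge reversing it contains neither of the two forbidden subgraphs, and
every coherently oriented cycle, loops excluded, is a connected component. -/
structure IsMP {V E : Type*} (G : LoopyDigraph V E) : Prop where
  no_triangle : ¬ G.ContainsTriangle
  no_alternating : ¬ G.ContainsAlternating
  no_triangle_reverse : ¬ G.reverse.ContainsTriangle
  no_alternating_reverse : ¬ G.reverse.ContainsAlternating
  cycle_component : ∀ (n : ℕ) (e : Fin (n + 1) → E), 1 ≤ n → G.IsCoherentCycle e →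
    ∃ C : G.underlying.ConnectedComponent,
      C.supp = Set.range (fun i => G.src (e i)) ∧ G.edgesOf C = Set.range e

/-- The edges `e 0, …, e (n - 1)` form a simple path through the distinct vertices
`p 0, …, p n`. For `n = 0` it is the single vertex `p 0`. -/
def IsSimplePath {V E : Type*} (G : LoopyDigraph V E) {n : ℕ} (p : Fin (n + 1) → V)
    (e : Fin n → E) : Prop :=
  Function.Injective p ∧ ∀ i, G.src (e i) = p i.castSucc ∧ G.tgt (e i) = p i.succ

/-- Each connected component of `G` is either a vertex or a simple path. -/
def IsUnionOfPaths {V E : Type*} (G : LoopyDigraph V E) : Prop :=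
  ∀ C : G.underlying.ConnectedComponent, ∃ (n : ℕ) (p : Fin (n + 1) → V) (e : Fin n → E),
    G.IsSimplePath p e ∧ Set.range p = C.supp ∧ Set.range e = G.edgesOf C

/-- The edge set `A` is (the edge set of) a multipath of `G`. -/
def IsMultipath {V E : Type*} (G : LoopyDigraph V E) (A : Set E) : Prop :=
  (G.spanning A).IsUnionOfPaths

/-- A flowing `k`-colouring. -/
def IsFlowing {V E : Type*} (G : LoopyDigraph V E) {k : ℕ} (c : V → Fin k) : Prop :=
  (∀ e, c (G.src e) ≠ c (G.tgt e)) ∧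
  (∀ e f, G.tgt e = G.tgt f → c (G.src e) = c (G.src f)) ∧
  (∀ e f, G.src e = G.src f → c (G.tgt e) = c (G.tgt f))

/-- The number of flowing `k`-colourings. -/
noncomputable def numFlowing {V E : Type*} (G : LoopyDigraph V E) (k : ℕ) : ℕ :=
  Nat.card {c : V → Fin k // G.IsFlowing c}

/-- `F` is the edge set of a spanning forest of `G`: on each connected component of `G` the
edges of `F` form a tree, as an undirected multigraph. Cycles of length one (loops) and two
(pairs of edges with the same ends) are not seen by the simple graph and are excluded first. -/
def IsSpanningForest {V E : Type*} (G : LoopyDigraph V E) (F : Set E) : Prop :=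
  (∀ e ∈ F, G.src e ≠ G.tgt e) ∧
  (∀ e ∈ F, ∀ f ∈ F, G.src e = G.tgt f → G.tgt e = G.src f → e = f) ∧
  ∀ C : G.underlying.ConnectedComponent, ((G.spanning F).underlying.induce C.supp).IsTree

/-! Multipaths of an MP-digraph are the independent sets of a matroid. -/

theorem reachable {V E : Type*} (G : LoopyDigraph V E) (e : E) :
    G.underlying.Reachable (G.src e) (G.tgt e) := by
  by_cases h : G.src e = G.tgt e
  · rw [h]
  · exact SimpleGraph.Adj.reachable ⟨h, e, Or.inl ⟨rfl, rfl⟩⟩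

theorem mem_supp_iff {V E : Type*} (G : LoopyDigraph V E) (C : G.underlying.ConnectedComponent)
    (e : E) : G.src e ∈ C.supp ↔ G.tgt e ∈ C.supp := by
  simp only [SimpleGraph.ConnectedComponent.mem_supp_iff]
  rw [SimpleGraph.ConnectedComponent.eq.mpr (G.reachable e)]

theorem IsCoherentCycle.reachable {V E : Type*} {G : LoopyDigraph V E} {n : ℕ}
    {e : Fin (n + 1) → E} (h : G.IsCoherentCycle e) (i : Fin (n + 1)) :
    G.underlying.Reachable (G.src (e 0)) (G.src (e i)) := by
  induction i using Fin.induction with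
  | zero => rfl
  | succ i ih =>
    refine ih.trans ?_
    have := h.1 i.castSucc
    rw [Fin.coeSucc_eq_succ] at this
    rw [← this]
    exact G.reachable _

theorem IsMP.edge_mem_cycle {V E : Type*} {G : LoopyDigraph V E} (hG : G.IsMP) {n : ℕ}
    {e : Fin (n + 1) → E} (hn : 1 ≤ n) (h : G.IsCoherentCycle e) (f : E)
    (hf : (∃ i, G.src f = G.src (e i)) ∨ ∃ i, G.tgt f = G.tgt (e i)) : ∃ i, e i = f := by
  obtain ⟨C, hC, hE⟩ := hG.cycle_component n e hn h
  have hsrc : ∀ i, G.src (e i) ∈ C.supp := fun i => hC ▸ Set.mem_range_self i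
  have : f ∈ G.edgesOf C := by
    rcases hf with ⟨i, hi⟩ | ⟨i, hi⟩
    · change G.src f ∈ C.supp
      rw [hi]; exact hsrc i
    · change G.src f ∈ C.supp
      rw [mem_supp_iff, hi, ← mem_supp_iff]; exact hsrc i
  rwa [hE] at this

theorem IsMP.spanning {V E : Type*} {G : LoopyDigraph V E} (hG : G.IsMP) (F : Set E) :
    (G.spanning F).IsMP where
  no_triangle := fun ⟨v₀, v₁, v₂, a, b, c, h⟩ => hG.no_triangle ⟨v₀, v₁, v₂, a, b, c, h⟩
  no_alternating := fun ⟨v₀, v₁, v₂, v₃, a, b, c, h⟩ =>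
    hG.no_alternating ⟨v₀, v₁, v₂, v₃, a, b, c, h⟩
  no_triangle_reverse := fun ⟨v₀, v₁, v₂, a, b, c, h⟩ =>
    hG.no_triangle_reverse ⟨v₀, v₁, v₂, a, b, c, h⟩
  no_alternating_reverse := fun ⟨v₀, v₁, v₂, v₃, a, b, c, h⟩ =>
    hG.no_alternating_reverse ⟨v₀, v₁, v₂, v₃, a, b, c, h⟩
  cycle_component := by
    intro n e hn he
    have he' : G.IsCoherentCycle (fun i => (e i : E)) := he
    obtain ⟨C, hC, hE⟩ := hG.cycle_component n _ hn he'
    set H := G.spanning F with hH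
    have hle : H.underlying ≤ G.underlying := by
      intro v w hvw
      obtain ⟨h1, f, hf⟩ := hvw
      exact ⟨h1, f, hf⟩
    have hsupp : (H.underlying.connectedComponentMk (H.src (e 0))).supp =
        Set.range (fun i => H.src (e i)) := by
      ext v
      rw [SimpleGraph.ConnectedComponent.mem_supp_iff, SimpleGraph.ConnectedComponent.eq]
      constructor
      · intro hv
        have h0 : G.src (e 0) ∈ C.supp := hC ▸ Set.mem_range_self (0 : Fin (n + 1))
        have : v ∈ C.supp := by
          rw [SimpleGraph.ConnectedComponent.mem_supp_iff] at h0 ⊢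
          rw [← h0, SimpleGraph.ConnectedComponent.eq]
          exact hv.mono hle
        rw [hC] at this
        exact this
      · rintro ⟨i, rfl⟩
        exact (he.reachable i).symm
    refine ⟨_, hsupp, ?_⟩
    ext f
    constructor
    · intro hf
      have hf : H.src f ∈ (H.underlying.connectedComponentMk (H.src (e 0))).supp := hf
      rw [hsupp] at hf
      obtain ⟨i, hi⟩ := hf
      obtain ⟨j, hj⟩ := hG.edge_mem_cycle hn he' (f : E) (Or.inl ⟨i, hi.symm⟩)
      exact ⟨j, Subtype.ext hj⟩
    · rintro ⟨i, rfl⟩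
      change H.src (e i) ∈ (H.underlying.connectedComponentMk (H.src (e 0))).supp
      rw [hsupp]
      exact ⟨i, rfl⟩

theorem IsUnionOfPaths.injective {V E : Type*} {G : LoopyDigraph V E} (h : G.IsUnionOfPaths) :
    Function.Injective G.src ∧ Function.Injective G.tgt := by
  constructor
  · intro a b hab
    obtain ⟨n, p, e, hp, _, hE⟩ := h (G.underlying.connectedComponentMk (G.src a))
    have ha : a ∈ Set.range e := by rw [hE]; rfl
    have hb : b ∈ Set.range e := by
      rw [hE]; change G.src b ∈ (G.underlying.connectedComponentMk (G.src a)).supp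
      rw [← hab]; rfl
    obtain ⟨i, rfl⟩ := ha
    obtain ⟨j, rfl⟩ := hb
    rw [(hp.2 i).1, (hp.2 j).1] at hab
    rw [Fin.castSucc_injective _ (hp.1 hab)]
  · intro a b hab
    obtain ⟨n, p, e, hp, _, hE⟩ := h (G.underlying.connectedComponentMk (G.src a))
    have ha' : G.src a ∈ (G.underlying.connectedComponentMk (G.src a)).supp := rfl
    have ha : a ∈ Set.range e := by rw [hE]; rfl
    have hb : b ∈ Set.range e := by
      rw [hE]; change G.src b ∈ (G.underlying.connectedComponentMk (G.src a)).supp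
      rw [mem_supp_iff, ← hab, ← mem_supp_iff]; exact ha'
    obtain ⟨i, rfl⟩ := ha
    obtain ⟨j, rfl⟩ := hb
    rw [(hp.2 i).2, (hp.2 j).2] at hab
    rw [Fin.succ_injective _ (hp.1 hab)]

theorem IsUnionOfPaths.acyclic {V E : Type*} {G : LoopyDigraph V E} (h : G.IsUnionOfPaths) :
    ¬ G.HasCoherentCycle := by
  rintro ⟨m, c, hc⟩
  obtain ⟨n, p, e, hp, _, hE⟩ := h (G.underlying.connectedComponentMk (G.src (c 0)))
  have hmem : ∀ i, ∃ j, e j = c i := by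
    intro i
    have : c i ∈ Set.range e := by
      rw [hE]
      change G.src (c i) ∈ (G.underlying.connectedComponentMk (G.src (c 0))).supp
      rw [SimpleGraph.ConnectedComponent.mem_supp_iff, SimpleGraph.ConnectedComponent.eq]
      exact (hc.reachable i).symm
    exact this
  choose j hj using hmem
  obtain ⟨i, hi⟩ := Finite.exists_max (fun i => j i)
  have h1 := hc.1 i
  rw [← hj i, ← hj (i + 1), (hp.2 _).2, (hp.2 _).1] at h1
  have h2 := congrArg Fin.val (hp.1 h1)
  have h3 := hi (i + 1)
  simp only [Fin.le_def, Fin.val_succ, Fin.val_castSucc] at h2 h3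
  omega

theorem IsSimplePath.closed {V E : Type*} {G : LoopyDigraph V E} {n : ℕ} {p : Fin (n + 1) → V}
    {e : Fin n → E} (hp : G.IsSimplePath p e) (f : E) (hs : G.src f = p (Fin.last n))
    (ht : G.tgt f = p 0) : G.HasCoherentCycle := by
  refine ⟨n, Fin.snoc (α := fun _ => E) e f, ?_, ?_⟩
  · intro i
    induction i using Fin.lastCases with
    | last =>
      rw [Fin.last_add_one, Fin.snoc_last, ht]
      cases n with
      | zero =>
        have : (0 : Fin 1) = Fin.last 0 := rfl
        rw [this, Fin.snoc_last, hs]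
      | succ n =>
        have : (0 : Fin (n + 1 + 1)) = Fin.castSucc (0 : Fin (n + 1)) := rfl
        rw [this, Fin.snoc_castSucc, (hp.2 0).1]
    | cast i =>
      rw [Fin.snoc_castSucc, Fin.coeSucc_eq_succ, (hp.2 i).2]
      by_cases hi : i.succ = Fin.last n
      · rw [hi, Fin.snoc_last, hs]
      · obtain ⟨k, hk⟩ := Fin.exists_castSucc_eq.mpr hi
        rw [← hk, Fin.snoc_castSucc, (hp.2 k).1]
  · have : (fun i => G.src (Fin.snoc (α := fun _ => E) e f i)) = p := by
      funext i
      induction i using Fin.lastCases with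
      | last => rw [Fin.snoc_last, hs]
      | cast i => rw [Fin.snoc_castSucc, (hp.2 i).1]
    rw [this]
    exact hp.1

theorem isUnionOfPaths_iff {V E : Type*} [Finite V] (G : LoopyDigraph V E) :
    G.IsUnionOfPaths ↔
      Function.Injective G.src ∧ Function.Injective G.tgt ∧ ¬ G.HasCoherentCycle := by
  refine ⟨fun h => ⟨h.injective.1, h.injective.2, h.acyclic⟩, ?_⟩
  rintro ⟨hs, ht, hc⟩ C
  let S : Set ℕ := {n | ∃ (p : Fin (n + 1) → V) (e : Fin n → E), G.IsSimplePath p e ∧ p 0 ∈ C.supp}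
  have hne : S.Nonempty := by
    obtain ⟨v, hv⟩ := C.nonempty_supp
    exact ⟨0, fun _ => v, Fin.elim0, ⟨fun a b _ => Fin.ext (by omega), fun i => i.elim0⟩, hv⟩
  have hbd : BddAbove S := by
    refine ⟨Nat.card V, ?_⟩
    rintro n ⟨p, e, hp, _⟩
    have := Nat.card_le_card_of_injective p hp.1
    simp only [Nat.card_eq_fintype_card, Fintype.card_fin] at this
    omega
  obtain ⟨p, e, hp, h0⟩ := Nat.sSup_mem hne hbd
  have hmax : ∀ m ∈ S, m ≤ sSup S := fun m hm => le_csSup hbd hm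
  generalize sSup S = n at p e hp h0 hmax
  have hin : ∀ i, p i ∈ C.supp := by
    intro i
    induction i using Fin.induction with
    | zero => exact h0
    | succ i ih =>
      rw [← (hp.2 i).2, ← mem_supp_iff, (hp.2 i).1]
      exact ih
  have hout : ∀ f i, G.src f = p i → ∃ j, e j = f := by
    intro f i hf
    induction i using Fin.lastCases with
    | cast i => exact ⟨i, hs ((hp.2 i).1.trans hf.symm)⟩
    | last =>
      exfalso
      by_cases hr : G.tgt f ∈ Set.range p
      · obtain ⟨j, hj⟩ := hr
        induction j using Fin.cases with
        | zero => exact hc (hp.closed f hf hj.symm)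
        | succ j =>
          have h1 : e j = f := ht ((hp.2 j).2.trans hj)
          rw [← h1, (hp.2 j).1] at hf
          exact Fin.castSucc_ne_last j (hp.1 hf)
      · have hS : n + 1 ∈ S := by
          refine ⟨Fin.snoc (α := fun _ => V) p (G.tgt f), Fin.snoc (α := fun _ => E) e f,
            ⟨?_, ?_⟩, ?_⟩
          · exact Fin.snoc_injective_of_injective hp.1 hr
          · intro i
            induction i using Fin.lastCases with
            | last =>
              rw [Fin.snoc_last, Fin.snoc_castSucc, Fin.succ_last, Fin.snoc_last]
              exact ⟨hf, rfl⟩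
            | cast i =>
              rw [Fin.snoc_castSucc, Fin.snoc_castSucc, Fin.succ_castSucc, Fin.snoc_castSucc]
              exact hp.2 i
          · have : (0 : Fin (n + 1 + 1)) = Fin.castSucc (0 : Fin (n + 1)) := rfl
            rw [this, Fin.snoc_castSucc]
            exact h0
        have := hmax _ hS
        omega
  have hinn : ∀ f i, G.tgt f = p i → ∃ j, e j = f := by
    intro f i hf
    induction i using Fin.cases with
    | succ i => exact ⟨i, ht ((hp.2 i).2.trans hf.symm)⟩
    | zero =>
      by_cases hr : G.src f ∈ Set.range p
      · obtain ⟨j, hj⟩ := hr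
        exact hout f j hj.symm
      · exfalso
        have hS : n + 1 ∈ S := by
          refine ⟨Fin.cons (α := fun _ => V) (G.src f) p, Fin.cons (α := fun _ => E) f e,
            ⟨?_, ?_⟩, ?_⟩
          · exact Fin.cons_injective_of_injective hr hp.1
          · intro i
            induction i using Fin.cases with
            | zero =>
              rw [Fin.cons_zero, Fin.castSucc_zero, Fin.cons_zero, Fin.cons_succ]
              exact ⟨rfl, hf⟩
            | succ i =>
              rw [Fin.cons_succ, Fin.cons_succ, ← Fin.succ_castSucc, Fin.cons_succ]
              exact hp.2 i
          · rw [Fin.cons_zero, mem_supp_iff, hf]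
            exact h0
        have := hmax _ hS
        omega
  have hsub : ∀ v w, G.underlying.Reachable v w → v ∈ Set.range p → w ∈ Set.range p := by
    rintro v w ⟨q⟩ hv
    induction q with
    | nil => exact hv
    | cons hadj _ ih =>
      apply ih
      obtain ⟨i, hi⟩ := hv
      obtain ⟨_, f, ⟨h1, h2⟩ | ⟨h1, h2⟩⟩ := hadj
      · obtain ⟨j, rfl⟩ := hout f i (h1.trans hi.symm)
        exact ⟨j.succ, (hp.2 j).2.symm.trans h2⟩
      · obtain ⟨j, rfl⟩ := hinn f i (h2.trans hi.symm)
        exact ⟨j.castSucc, (hp.2 j).1.symm.trans h1⟩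
  have hrange : Set.range p = C.supp := by
    ext w
    constructor
    · rintro ⟨i, rfl⟩; exact hin i
    · intro hw
      rw [SimpleGraph.ConnectedComponent.mem_supp_iff] at hw h0
      exact hsub _ _ (SimpleGraph.ConnectedComponent.eq.mp (h0.trans hw.symm)) ⟨0, rfl⟩
  refine ⟨n, p, e, hp, hrange, ?_⟩
  ext f
  constructor
  · rintro ⟨i, rfl⟩
    change G.src (e i) ∈ C.supp
    rw [(hp.2 i).1]; exact hin _
  · intro hf
    have hf : G.src f ∈ C.supp := hf
    rw [← hrange] at hf
    obtain ⟨i, hi⟩ := hf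
    exact hout f i hi.symm

theorem isMultipath_iff {V E : Type*} [Finite V] (G : LoopyDigraph V E) (A : Set E) :
    G.IsMultipath A ↔ Set.InjOn G.src A ∧ Set.InjOn G.tgt A ∧
      ∀ (n : ℕ) (e : Fin (n + 1) → E), G.IsCoherentCycle e → ¬ Set.range e ⊆ A := by
  rw [IsMultipath, isUnionOfPaths_iff, Set.injOn_iff_injective, Set.injOn_iff_injective]
  refine and_congr Iff.rfl (and_congr Iff.rfl ?_)
  constructor
  · intro h n e he hA
    exact h ⟨n, fun i => ⟨e i, hA ⟨i, rfl⟩⟩, he⟩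
  · rintro h ⟨n, e, he⟩
    refine h n (fun i => e i) he ?_
    rintro _ ⟨i, rfl⟩
    exact (e i).2

theorem IsMultipath.subset {V E : Type*} [Finite V] {G : LoopyDigraph V E} {A B : Set E}
    (hB : G.IsMultipath B) (h : A ⊆ B) : G.IsMultipath A := by
  rw [isMultipath_iff] at *
  exact ⟨hB.1.mono h, hB.2.1.mono h, fun n e he hA => hB.2.2 n e he (hA.trans h)⟩

theorem isMultipath_empty {V E : Type*} [Finite V] (G : LoopyDigraph V E) :
    G.IsMultipath ∅ := by
  rw [isMultipath_iff]
  exact ⟨Set.injOn_empty _, Set.injOn_empty _, fun n e _ h => h ⟨0, rfl⟩⟩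

theorem IsMultipath.not_loop {V E : Type*} [Finite V] {G : LoopyDigraph V E} {A : Set E}
    (hA : G.IsMultipath A) {e : E} (he : e ∈ A) : G.src e ≠ G.tgt e := by
  intro h
  refine ((isMultipath_iff G A).mp hA).2.2 0 (fun _ => e)
    ⟨fun _ => h.symm, fun a b _ => Fin.ext (by omega)⟩ ?_
  rintro _ ⟨i, rfl⟩
  exact he

/-- If `f` shares its source with `e` and its target with `e'`, all non-loops, then `e` and `e'`
have the same source or the same target. -/
theorem IsMP.share {V E : Type*} {G : LoopyDigraph V E} (hG : G.IsMP) {e e' f : E}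
    (he : G.src e ≠ G.tgt e) (he' : G.src e' ≠ G.tgt e') (hf : G.src f ≠ G.tgt f)
    (h1 : G.src e = G.src f) (h2 : G.tgt e' = G.tgt f) :
    G.src e = G.src e' ∨ G.tgt e = G.tgt e' := by
  by_contra hcon
  push Not at hcon
  obtain ⟨hc1, hc2⟩ := hcon
  rw [h1] at he hc1
  rw [h2] at he' hc2
  by_cases h : G.src e' = G.tgt e
  · exact hG.no_triangle ⟨G.tgt e, G.src f, G.tgt f, e, e', f, he.symm, hc2, hf, ⟨h1, rfl⟩,
      ⟨h, h2⟩, ⟨rfl, rfl⟩⟩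
  · exact hG.no_alternating ⟨G.src e', G.tgt f, G.src f, G.tgt e, e', f, e, he', hc1.symm, h,
      hf.symm, hc2.symm, he, ⟨rfl, h2⟩, ⟨rfl, rfl⟩, ⟨h1, rfl⟩⟩

theorem IsMP.aug {V E : Type*} [Finite V] [Finite E] {G : LoopyDigraph V E} (hG : G.IsMP)
    {I J : Set E} (hI : G.IsMultipath I) (hJ : G.IsMultipath J) (hIJ : I.ncard < J.ncard) :
    ∃ e ∈ J, e ∉ I ∧ G.IsMultipath (insert e I) := by
  classical
  by_contra hcon
  push Not at hcon
  have hI' := (isMultipath_iff G I).mp hI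
  have hJ' := (isMultipath_iff G J).mp hJ
  -- Each edge of `J` blocks an edge of `I`.
  have key : ∀ e ∈ J, ∃ f ∈ I, (e ∈ I ∧ f = e) ∨ (e ∉ I ∧ (G.src e = G.src f ∨
      G.tgt e = G.tgt f ∨ (f ∉ J ∧ ∃ (n : ℕ) (c : Fin (n + 1) → E), 1 ≤ n ∧
        G.IsCoherentCycle c ∧ Set.range c ⊆ insert e I ∧ f ∈ Set.range c ∧
          e ∈ Set.range c))) := by
    intro e he
    by_cases heI : e ∈ I
    · exact ⟨e, heI, Or.inl ⟨heI, rfl⟩⟩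
    have hn := hcon e he heI
    by_cases h1 : ∃ f ∈ I, G.src e = G.src f
    · obtain ⟨f, hf, h⟩ := h1
      exact ⟨f, hf, Or.inr ⟨heI, Or.inl h⟩⟩
    by_cases h2 : ∃ f ∈ I, G.tgt e = G.tgt f
    · obtain ⟨f, hf, h⟩ := h2
      exact ⟨f, hf, Or.inr ⟨heI, Or.inr (Or.inl h)⟩⟩
    push Not at h1 h2
    rw [isMultipath_iff, Set.injOn_insert heI, Set.injOn_insert heI] at hn
    have h3 : ∃ (n : ℕ) (c : Fin (n + 1) → E), G.IsCoherentCycle c ∧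
        Set.range c ⊆ insert e I := by
      by_contra h3
      push Not at h3
      refine hn ⟨⟨hI'.1, ?_⟩, ⟨hI'.2.1, ?_⟩, h3⟩
      · rintro ⟨f, hf, h⟩; exact h1 f hf h.symm
      · rintro ⟨f, hf, h⟩; exact h2 f hf h.symm
    obtain ⟨n, c, hc, hsub⟩ := h3
    have hcJ := hJ'.2.2 n c hc
    rw [Set.not_subset] at hcJ
    obtain ⟨f, hfc, hfJ⟩ := hcJ
    have hfI : f ∈ I := by
      rcases hsub hfc with rfl | h
      · exact absurd he hfJ
      · exact h
    have hec : e ∈ Set.range c := by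
      by_contra hec
      refine hI'.2.2 n c hc fun x hx => ?_
      rcases hsub hx with rfl | h
      · exact absurd hx hec
      · exact h
    refine ⟨f, hfI, Or.inr ⟨heI, Or.inr (Or.inr ⟨hfJ, n, c, ?_, hc, hsub, hfc, hec⟩)⟩⟩
    rcases Nat.eq_zero_or_pos n with rfl | h
    · exfalso
      obtain ⟨i, rfl⟩ := hfc
      obtain ⟨j, rfl⟩ := hec
      rw [Subsingleton.elim (α := Fin 1) i j] at hfI
      exact heI hfI
    · exact h
  choose! φ hφI hφ using key
  have hinj : Set.InjOn φ J := by
    intro a ha b hb hab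
    -- an edge of a long cycle is not blocked in two ways
    have cyc : ∀ a ∈ J, ∀ b ∈ J, φ a = φ b →
        (∃ (n : ℕ) (c : Fin (n + 1) → E), 1 ≤ n ∧ G.IsCoherentCycle c ∧
          Set.range c ⊆ insert a I ∧ φ a ∈ Set.range c ∧ a ∈ Set.range c) →
        φ a ∉ J → a = b := by
      rintro a ha b hb hab ⟨n, c, hn, hc, hsub, ⟨i, hi⟩, hac⟩ hnJ
      have hbc : b ∉ I ∧ b ∈ Set.range c := by
        rcases hφ b hb with ⟨_, h⟩ | ⟨hbI, h | h | ⟨_, m, d, hm, hd, hdsub, hfd, hbd⟩⟩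
        · exact absurd hb (by rw [← h, ← hab]; exact hnJ)
        · exact ⟨hbI, hG.edge_mem_cycle hn hc b (Or.inl ⟨i, by rw [hi, hab, h]⟩)⟩
        · exact ⟨hbI, hG.edge_mem_cycle hn hc b (Or.inr ⟨i, by rw [hi, hab, h]⟩)⟩
        · refine ⟨hbI, ?_⟩
          obtain ⟨C, hC, hCE⟩ := hG.cycle_component n c hn hc
          obtain ⟨D, hD, hDE⟩ := hG.cycle_component m d hm hd
          have h1 : G.src (φ a) ∈ C.supp := by
            change φ a ∈ G.edgesOf C
            rw [hCE]; exact ⟨i, hi⟩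
          have h2 : G.src (φ a) ∈ D.supp := by
            change φ a ∈ G.edgesOf D
            rw [hDE, hab]; exact hfd
          rw [SimpleGraph.ConnectedComponent.mem_supp_iff] at h1 h2
          have hCD : C = D := h1.symm.trans h2
          rw [← hCE, hCD, hDE]
          exact hbd
      rcases hsub hbc.2 with h | h
      · exact h.symm
      · exact absurd h hbc.1
    have hla := hJ.not_loop ha
    have hlb := hJ.not_loop hb
    have hlf := hI.not_loop (hφI a ha)
    have hsa := hφ a ha
    have hsb := hφ b hb
    have hA : (φ a ∉ J ∧ ∃ (n : ℕ) (c : Fin (n + 1) → E), 1 ≤ n ∧ G.IsCoherentCycle c ∧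
          Set.range c ⊆ insert a I ∧ φ a ∈ Set.range c ∧ a ∈ Set.range c) ∨
        G.src a = G.src (φ a) ∨ G.tgt a = G.tgt (φ a) := by
      rcases hsa with ⟨_, h⟩ | ⟨_, h | h | h⟩
      · exact Or.inr (Or.inl (by rw [h]))
      · exact Or.inr (Or.inl h)
      · exact Or.inr (Or.inr h)
      · exact Or.inl h
    have hB : (φ b ∉ J ∧ ∃ (n : ℕ) (c : Fin (n + 1) → E), 1 ≤ n ∧ G.IsCoherentCycle c ∧
          Set.range c ⊆ insert b I ∧ φ b ∈ Set.range c ∧ b ∈ Set.range c) ∨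
        G.src b = G.src (φ b) ∨ G.tgt b = G.tgt (φ b) := by
      rcases hsb with ⟨_, h⟩ | ⟨_, h | h | h⟩
      · exact Or.inr (Or.inl (by rw [h]))
      · exact Or.inr (Or.inl h)
      · exact Or.inr (Or.inr h)
      · exact Or.inl h
    rcases hA with ⟨h1, h2⟩ | hA
    · exact cyc a ha b hb hab h2 h1
    rcases hB with ⟨h1, h2⟩ | hB
    · exact (cyc b hb a ha hab.symm h2 h1).symm
    rw [← hab] at hB
    have hshare : G.src a = G.src b ∨ G.tgt a = G.tgt b := by
      rcases hA with hA | hA <;> rcases hB with hB | hB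
      · exact Or.inl (hA.trans hB.symm)
      · exact hG.share hla hlb hlf hA hB
      · exact (hG.share hlb hla hlf hB hA).imp Eq.symm Eq.symm
      · exact Or.inr (hA.trans hB.symm)
    rcases hshare with h | h
    · exact hJ'.1 ha hb h
    · exact hJ'.2.1 ha hb h
  have := Set.ncard_le_ncard_of_injOn φ (fun a ha => hφI a ha) hinj (Set.toFinite I)
  omega

/-- The multipath matroid of an MP-digraph: its ground set is the set of all edges, its
independent sets are the multipaths. -/
def multipathMatroid {V E : Type*} [Finite V] [Finite E] (G : LoopyDigraph V E) (hG : G.IsMP) :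
    Matroid E :=
  (IndepMatroid.ofFinite (E := Set.univ) Set.finite_univ G.IsMultipath G.isMultipath_empty
    (fun _ _ hJ h => hJ.subset h) (fun _ _ hI hJ h => hG.aug hI hJ h)
    (fun _ _ => Set.subset_univ _)).matroid

theorem multipathMatroid_ground {V E : Type*} [Finite V] [Finite E] (G : LoopyDigraph V E)
    (hG : G.IsMP) : (G.multipathMatroid hG).E = Set.univ := rfl

theorem multipathMatroid_indep {V E : Type*} [Finite V] [Finite E] (G : LoopyDigraph V E)
    (hG : G.IsMP) (I : Set E) : (G.multipathMatroid hG).Indep I ↔ G.IsMultipath I := by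
  simp [multipathMatroid, IndepMatroid.ofFinite]

instance multipathMatroid_finite {V E : Type*} [Finite V] [Finite E] (G : LoopyDigraph V E)
    (hG : G.IsMP) : (G.multipathMatroid hG).Finite := ⟨Set.toFinite _⟩

end LoopyDigraph

/-- The rank of a set in a finite matroid, as a natural number. -/
noncomputable def Matroid.natRk {α : Type*} (M : Matroid α) (A : Set α) : ℕ :=
  (M.eRk A).toNat

/-- The Tutte polynomial `∑ (x - 1) ^ (r(M) - r(A)) * (y - 1) ^ (|A| - r(A))`, the sum over all
subsets `A` of the ground set of a finite matroid, with variables `x = X 0` and `y = X 1`. Both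
exponents are differences `m - n` with `n ≤ m`. -/
noncomputable def Matroid.tuttePoly {α : Type*} (M : Matroid α) [M.Finite] :
    MvPolynomial (Fin 2) ℤ :=
  ∑ A ∈ M.ground_finite.toFinset.powerset,
    (MvPolynomial.X 0 - 1) ^ (M.natRk M.E - M.natRk (A : Set α)) *
      (MvPolynomial.X 1 - 1) ^ (A.card - M.natRk (A : Set α))

/-- The rank `r(G)` of an MP-digraph: the rank of the ground set of its multipath matroid. -/
noncomputable def LoopyDigraph.rank {V E : Type*} [Finite V] [Finite E] (G : LoopyDigraph V E)
    (hG : G.IsMP) : ℕ :=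
  (G.multipathMatroid hG).natRk (G.multipathMatroid hG).E

/-! Both sides equal $k^{p_0(G)}(1-k)^{r(G)}$. Matroid side: in an MP-digraph without coherently
oriented cycles, "same source or same target" is an equivalence relation on edges
(`IsMP.edgeSetoid`); transitivity is what the forbidden subgraphs give. With no cycles to avoid, a
multipath is a set with at most one edge from each class. So $M_G$ is a direct sum of uniform
matroids $U_{1,m}$, $m \ge 1$, one per class. Each has Tutte polynomial $x + y + \dots + y^{m-1}$,
which is $x$ at $y = 0$, whence $T_{M_G}(x,0) = x^{r(G)}$ (`IsMP.eval_tuttePoly`). Colouring side: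
for $k \ge 1$ the colours form the group $\mathbb{Z}/k$. A colouring $c$ is flowing exactly when its
coboundary $c(\mathrm{tgt}) - c(\mathrm{src})$ is nowhere zero and constant on the edge classes of
$S$ (`isFlowing_iff_coboundary`). There are $(k-1)^{r(S)}$ such edge functions. As $S$ is a spanning
forest, the coboundary is onto with kernel of size $k^{p_0(G)}$, so $\tau_S(k) =
k^{p_0(G)}(k-1)^{r(S)}$. The hypothesis $r(S) = r(G)$ matches the exponents. -/

/-! ### The Tutte polynomial of a partition matroid at $y = 0$ -/

/-- This is the rank expansion at $y = 0$ for the partition matroid of the fibres of `f`, with `x`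
in the role of $x - 1$. Each term is expanded over subsets `T` of `Q`; after exchanging the sums,
the alternating sum over the sets `A` that avoid $f^{-1}(T)$ vanishes unless `T` is all of `Q`. -/
theorem Finset.sum_powerset_pow_card_image {E Q R : Type*} [Fintype E] [Fintype Q]
    [DecidableEq E] [DecidableEq Q] [CommRing R] (f : E → Q) (hf : Function.Surjective f) (x : R) :
    ∑ A : Finset E, x ^ (Fintype.card Q - (A.image f).card) * (-1) ^ (A.card - (A.image f).card) =
      (x + 1) ^ Fintype.card Q := by
  have h1 : ∀ A : Finset E,
      x ^ (Fintype.card Q - (A.image f).card) * (-1) ^ (A.card - (A.image f).card) =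
        ∑ T : Finset Q, (x + 1) ^ T.card * (-1) ^ Tᶜ.card *
          if A ⊆ (Finset.univ.filter fun e => f e ∉ T) then (-1 : R) ^ A.card else 0 := by
    intro A
    have hsign : (-1 : R) ^ (A.card - (A.image f).card) =
        (-1) ^ (A.image f).card * (-1) ^ A.card := by
      obtain ⟨m, hm⟩ := Nat.exists_eq_add_of_le (Finset.card_image_le (s := A) (f := f))
      rw [hm, Nat.add_sub_cancel_left, pow_add, ← mul_assoc, ← mul_pow]
      simp
    have hprod : x ^ (Fintype.card Q - (A.image f).card) * (-1) ^ (A.image f).card =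
        ∏ q : Q, ((if q ∈ A.image f then 0 else (x + 1)) + (-1)) := by
      -- Writing $x = (x+1) - 1$ and $-1 = 0 + (-1)$ makes every factor a binomial. In the
      -- expansion, `T` collects the factors that contribute the first summand; only `T` disjoint
      -- from `f(A)` survives.
      have : ∀ q : Q, ((if q ∈ A.image f then 0 else (x + 1)) + (-1)) =
          if q ∈ A.image f then -1 else x := by
        intro q; split_ifs <;> ring
      rw [Finset.prod_congr rfl fun q _ => this q, Finset.prod_ite]
      simp only [Finset.prod_const]
      rw [mul_comm, ← Finset.card_compl]
      congr 3 <;> · ext; simp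
    rw [hsign, ← mul_assoc, hprod, Fintype.prod_add, Finset.sum_mul]
    refine Finset.sum_congr rfl fun T _ => ?_
    rw [Finset.prod_const]
    by_cases hT : A ⊆ Finset.univ.filter fun e => f e ∉ T
    · rw [if_pos hT]
      congr 2
      rw [← Finset.prod_const]
      refine Finset.prod_congr rfl fun q hq => if_neg fun h => ?_
      obtain ⟨e, he, rfl⟩ := Finset.mem_image.mp h
      exact (Finset.mem_filter.mp (hT he)).2 hq
    · rw [if_neg hT, mul_zero]
      rw [Finset.not_subset] at hT
      obtain ⟨e, he, heT⟩ := hT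
      simp only [Finset.mem_filter, Finset.mem_univ, true_and, not_not] at heT
      rw [Finset.prod_eq_zero (f := fun q => if q ∈ A.image f then 0 else x + 1) heT
        (if_pos (Finset.mem_image_of_mem f he)), zero_mul, zero_mul]
  rw [Finset.sum_congr rfl fun A _ => h1 A, Finset.sum_comm]
  have h2 : ∀ T : Finset Q, (∑ A : Finset E, (x + 1) ^ T.card * (-1) ^ Tᶜ.card *
      if A ⊆ (Finset.univ.filter fun e => f e ∉ T) then (-1 : R) ^ A.card else 0) =
      if T = Finset.univ then (x + 1) ^ Fintype.card Q else 0 := by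
    intro T
    have h3 : (∑ A : Finset E, if A ⊆ (Finset.univ.filter fun e => f e ∉ T)
        then (-1 : R) ^ A.card else 0) =
        ((if (Finset.univ.filter fun e => f e ∉ T) = ∅ then 1 else 0 : ℤ) : R) := by
      rw [← Finset.sum_powerset_neg_one_pow_card, ← Finset.sum_filter]
      push_cast
      refine Finset.sum_congr ?_ fun _ _ => rfl
      ext A
      simp
    rw [← Finset.mul_sum, h3]
    by_cases hT : T = Finset.univ
    · subst hT; simp
    · rw [if_neg hT, if_neg, Int.cast_zero, mul_zero]
      -- If no edge lies outside $f^{-1}(T)$, surjectivity of `f` forces `T` to be everything.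
      intro h
      refine hT (Finset.eq_univ_iff_forall.mpr fun q => ?_)
      obtain ⟨e, rfl⟩ := hf q
      by_contra hq
      have : e ∈ Finset.univ.filter fun e => f e ∉ T := by simpa using hq
      rw [h] at this
      simp at this
  rw [Finset.sum_congr rfl fun T _ => h2 T]
  simp

/-- If the independent sets are the sets on which `f` is injective, then the rank of `A` is the
cardinality of `f '' A`. -/
theorem Matroid.natRk_eq_ncard_image {E Q : Type*} (M : Matroid E) (hE : M.E = Set.univ)
    (f : E → Q) (h : ∀ I, M.Indep I ↔ Set.InjOn f I) (A : Set E) :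
    M.natRk A = (f '' A).ncard := by
  -- One representative from each fibre meeting `A` is a basis of `A`: any further element of `A`
  -- repeats a value of `f`.
  obtain ⟨I, hIA, hI⟩ := Set.exists_subset_bijOn A f
  have hb : M.IsBasis I A := by
    rw [Matroid.isBasis_iff (hE ▸ Set.subset_univ A)]
    refine ⟨(h I).mpr hI.injOn, hIA, fun J hJ hIJ hJA => ?_⟩
    refine hIJ.antisymm fun e he => ?_
    obtain ⟨e', he', hee⟩ := hI.surjOn (Set.mem_image_of_mem f (hJA he))
    rwa [← (h J).mp hJ (hIJ he') he hee]
  rw [Matroid.natRk, ← hb.encard_eq_eRk, ← hI.injOn.encard_image, hI.image_eq, Set.ncard_def]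

theorem Matroid.eval_tuttePoly_of_indep_iff_injOn {E Q : Type*} [Finite E] (M : Matroid E)
    [M.Finite] (hE : M.E = Set.univ) (f : E → Q) (hf : Function.Surjective f)
    (h : ∀ I, M.Indep I ↔ Set.InjOn f I) (x : ℤ) :
    MvPolynomial.eval ![x, 0] M.tuttePoly = x ^ Nat.card Q := by
  classical
  have := Finite.of_surjective f hf
  have := Fintype.ofFinite E
  have := Fintype.ofFinite Q
  have hrk : ∀ A : Finset E, M.natRk (A : Set E) = (A.image f).card := by
    intro A
    rw [M.natRk_eq_ncard_image hE f h, ← Finset.coe_image, Set.ncard_coe_finset]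
  have hrkE : M.natRk M.E = Fintype.card Q := by
    rw [M.natRk_eq_ncard_image hE f h, hE, Set.image_univ, hf.range_eq, Set.ncard_univ,
      Nat.card_eq_fintype_card]
  have hpow : M.ground_finite.toFinset.powerset = Finset.univ := by
    ext A
    simp [hE]
  rw [Matroid.tuttePoly, hpow, map_sum, Nat.card_eq_fintype_card]
  have := Finset.sum_powerset_pow_card_image f hf (x - 1)
  rw [sub_add_cancel] at this
  rw [← this]
  refine Finset.sum_congr rfl fun A _ => ?_
  simp [hrk, hrkE]

namespace LoopyDigraph

/-! ### Edge classes and the multipath matroid -/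

theorem src_ne_tgt {V E : Type*} {G : LoopyDigraph V E} (hcyc : ¬ G.HasCoherentCycle) (e : E) :
    G.src e ≠ G.tgt e :=
  fun h => hcyc ⟨0, fun _ => e, fun _ => h.symm, fun a b _ => Fin.ext (by omega)⟩

theorem not_hasCoherentCycle_spanning {V E : Type*} {G : LoopyDigraph V E}
    (hcyc : ¬ G.HasCoherentCycle) (F : Set E) : ¬ (G.spanning F).HasCoherentCycle :=
  fun ⟨n, e, he⟩ => hcyc ⟨n, fun i => e i, he⟩

/-- Two edges of an MP-digraph without coherently oriented cycles are equivalent if they have the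
same source or the same target. -/
def IsMP.edgeSetoid {V E : Type*} {G : LoopyDigraph V E} (hG : G.IsMP)
    (hcyc : ¬ G.HasCoherentCycle) : Setoid E where
  r e f := G.src e = G.src f ∨ G.tgt e = G.tgt f
  iseqv :=
    { refl := fun _ => Or.inl rfl
      symm := fun h => h.imp Eq.symm Eq.symm
      trans := by
        rintro a b c (h | h) (h' | h')
        · exact Or.inl (h.trans h')
        -- Mixed case: `b` shares its source with `a` and its target with `c`. Were `a` and `c`
        -- inequivalent, the three edges would form a forbidden triangle or alternating path.
        · exact hG.share (src_ne_tgt hcyc a) (src_ne_tgt hcyc c) (src_ne_tgt hcyc b) h h'.symm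
        · exact (hG.share (src_ne_tgt hcyc c) (src_ne_tgt hcyc a) (src_ne_tgt hcyc b)
            h'.symm h).imp Eq.symm Eq.symm
        · exact Or.inr (h.trans h') }

theorem IsMP.mk_eq_mk_iff {V E : Type*} {G : LoopyDigraph V E} (hG : G.IsMP)
    (hcyc : ¬ G.HasCoherentCycle) (e f : E) :
    Quotient.mk (hG.edgeSetoid hcyc) e = Quotient.mk (hG.edgeSetoid hcyc) f ↔
      G.src e = G.src f ∨ G.tgt e = G.tgt f :=
  Quotient.eq

/-- The multipath matroid is the partition matroid of the equivalence classes of edges. -/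
theorem IsMP.indep_iff_injOn {V E : Type*} [Finite V] [Finite E] {G : LoopyDigraph V E}
    (hG : G.IsMP) (hcyc : ¬ G.HasCoherentCycle) (I : Set E) :
    (G.multipathMatroid hG).Indep I ↔ Set.InjOn (Quotient.mk (hG.edgeSetoid hcyc)) I := by
  rw [multipathMatroid_indep, isMultipath_iff]
  constructor
  · rintro ⟨hs, ht, -⟩ a ha b hb hab
    rcases (hG.mk_eq_mk_iff hcyc a b).mp hab with h | h
    · exact hs ha hb h
    · exact ht ha hb h
  · intro h
    exact ⟨fun a ha b hb hab => h ha hb ((hG.mk_eq_mk_iff hcyc a b).mpr (Or.inl hab)),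
      fun a ha b hb hab => h ha hb ((hG.mk_eq_mk_iff hcyc a b).mpr (Or.inr hab)),
      fun n e he => absurd ⟨n, e, he⟩ hcyc⟩

theorem IsMP.rank_eq_card_quotient {V E : Type*} [Finite V] [Finite E] {G : LoopyDigraph V E}
    (hG : G.IsMP) (hcyc : ¬ G.HasCoherentCycle) :
    G.rank hG = Nat.card (Quotient (hG.edgeSetoid hcyc)) := by
  rw [rank, Matroid.natRk_eq_ncard_image _ rfl _ (hG.indep_iff_injOn hcyc),
    multipathMatroid_ground, Set.image_univ, Quotient.mk_surjective.range_eq, Set.ncard_univ]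

theorem IsMP.eval_tuttePoly {V E : Type*} [Finite V] [Finite E] {G : LoopyDigraph V E}
    (hG : G.IsMP) (hcyc : ¬ G.HasCoherentCycle) (x : ℤ) :
    MvPolynomial.eval ![x, 0] (G.multipathMatroid hG).tuttePoly = x ^ G.rank hG := by
  rw [hG.rank_eq_card_quotient hcyc]
  exact Matroid.eval_tuttePoly_of_indep_iff_injOn _ rfl _ Quotient.mk_surjective
    (hG.indep_iff_injOn hcyc) x

/-! ### Spanning forests and the coboundary map -/

/-- The number of vertices of a spanning forest is the number of its edges plus the number of
components. -/
theorem IsSpanningForest.card_add_numComponents {V E : Type*} [Finite V] [Finite E]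
    {G : LoopyDigraph V E} {F : Set E} (hF : G.IsSpanningForest F) :
    Nat.card F + G.numComponents = Nat.card V := by
  classical
  have := Fintype.ofFinite V
  have := Fintype.ofFinite E
  have := Fintype.ofFinite G.underlying.ConnectedComponent
  obtain ⟨hloop, hpair, htree⟩ := hF
  let e₁ : F ≃ Σ C : G.underlying.ConnectedComponent,
      {f : F // G.underlying.connectedComponentMk (G.src f) = C} :=
    (Equiv.sigmaFiberEquiv fun f : F => G.underlying.connectedComponentMk (G.src f)).symm
  let e₂ : V ≃ Σ C : G.underlying.ConnectedComponent,
      {v : V // G.underlying.connectedComponentMk v = C} :=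
    (Equiv.sigmaFiberEquiv fun v : V => G.underlying.connectedComponentMk v).symm
  have key : ∀ C : G.underlying.ConnectedComponent,
      Nat.card {f : F // G.underlying.connectedComponentMk (G.src f) = C} + 1 =
        Nat.card {v : V // G.underlying.connectedComponentMk v = C} := by
    intro C
    have hC := (htree C).card_edgeFinset
    rw [← Nat.card_eq_fintype_card (α := C.supp)] at hC
    refine Eq.trans ?_ hC
    congr 1
    rw [SimpleGraph.edgeFinset, Set.toFinset_card, ← Nat.card_eq_fintype_card]
    have htgt : ∀ f : E, G.src f ∈ C.supp → G.tgt f ∈ C.supp :=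
      fun f hf => (G.mem_supp_iff C f).mp hf
    -- The tree formula counts edges of a simple graph. Passing to unordered pairs loses no edge of
    -- the forest: `unique_edge` excludes parallel edges and `hpair` antiparallel ones.
    refine Nat.card_eq_of_bijective (fun f => ⟨s(⟨G.src f.1, f.2⟩, ⟨G.tgt f.1, htgt _ f.2⟩),
      ?_⟩) ⟨?_, ?_⟩
    · rw [SimpleGraph.mem_edgeSet]
      exact ⟨hloop _ f.1.2, f.1, Or.inl ⟨rfl, rfl⟩⟩
    · rintro ⟨f, hf⟩ ⟨g, hg⟩ hfg
      have hfg := congrArg Subtype.val hfg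
      simp only [Sym2.eq_iff, Subtype.mk.injEq] at hfg
      rcases hfg with ⟨h1, h2⟩ | ⟨h1, h2⟩
      · exact Subtype.ext (Subtype.ext (G.unique_edge _ _ (hloop _ f.2)
          (congrArg Subtype.val h1) h2))
      · exact Subtype.ext (Subtype.ext (hpair _ f.2 _ g.2
          (congrArg Subtype.val h1) (congrArg Subtype.val h2)))
    · rintro ⟨s, hs⟩
      induction s using Sym2.ind with
      | _ v w =>
        obtain ⟨v, hv⟩ := v
        obtain ⟨w, hw⟩ := w
        rw [SimpleGraph.mem_edgeSet] at hs
        obtain ⟨-, f, ⟨h1, h2⟩ | ⟨h1, h2⟩⟩ := hs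
        · change G.src f = v at h1
          change G.tgt f = w at h2
          subst h1 h2
          exact ⟨⟨f, hv⟩, rfl⟩
        · change G.src f = w at h1
          change G.tgt f = v at h2
          subst h1 h2
          exact ⟨⟨f, hw⟩, Subtype.ext Sym2.eq_swap⟩
  rw [Nat.card_congr e₁, Nat.card_congr e₂, Nat.card_sigma, Nat.card_sigma, numComponents,
    Nat.card_eq_fintype_card (α := G.underlying.ConnectedComponent), ← Finset.card_univ,
    Finset.card_eq_sum_ones, ← Finset.sum_add_distrib]
  exact Finset.sum_congr rfl fun C _ => key C

/-- The coboundary map, sending a function on the vertices to its differences along the edges. -/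
def coboundary {V E : Type*} (G : LoopyDigraph V E) (A : Type*) [AddCommGroup A] :
    (V → A) →+ (E → A) where
  toFun c e := c (G.tgt e) - c (G.src e)
  map_zero' := by ext; simp
  map_add' c d := by ext; simp only [Pi.add_apply]; abel

/-- A zero coboundary means no change along forest edges, and the forest connects each component of
`G`. Only the connectedness of the trees enters. -/
theorem IsSpanningForest.eq_of_mem_ker {V E A : Type*} [AddCommGroup A] {G : LoopyDigraph V E}
    {F : Set E} (hF : G.IsSpanningForest F) {c : V → A}
    (hc : c ∈ ((G.spanning F).coboundary A).ker) {v w : V} (h : G.underlying.Reachable v w) :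
    c v = c w := by
  have step : ∀ e : F, c (G.tgt e) = c (G.src e) := fun e => sub_eq_zero.mp (congrFun hc e)
  have hv : v ∈ (G.underlying.connectedComponentMk v).supp := rfl
  have hw : w ∈ (G.underlying.connectedComponentMk v).supp :=
    SimpleGraph.ConnectedComponent.eq.mpr h.symm
  obtain ⟨p⟩ := (hF.2.2 (G.underlying.connectedComponentMk v)).connected.preconnected
    ⟨v, hv⟩ ⟨w, hw⟩
  have walk : ∀ {x y : (G.underlying.connectedComponentMk v).supp}
      (_ : ((G.spanning F).underlying.induce _).Walk x y), c x = c y := by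
    intro x y p
    induction p with
    | nil => rfl
    | cons hadj _ ih =>
      refine Eq.trans ?_ ih
      obtain ⟨-, f, ⟨h1, h2⟩ | ⟨h1, h2⟩⟩ := hadj
      · exact (congrArg c h1).symm.trans ((step f).symm.trans (congrArg c h2))
      · exact (congrArg c h2).symm.trans ((step f).trans (congrArg c h1))
  exact walk p

/-- The kernel consists of the functions pulled back from the set of components of `G`. -/
theorem IsSpanningForest.card_ker_coboundary {V E A : Type*} [Finite V] [AddCommGroup A]
    {G : LoopyDigraph V E} {F : Set E} (hF : G.IsSpanningForest F) :
    Nat.card ((G.spanning F).coboundary A).ker = Nat.card A ^ G.numComponents := by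
  rw [numComponents, ← Nat.card_fun]
  refine (Nat.card_eq_of_bijective
    (fun c : G.underlying.ConnectedComponent → A =>
      (⟨fun v => c (G.underlying.connectedComponentMk v), ?_⟩ :
        ((G.spanning F).coboundary A).ker)) ⟨?_, ?_⟩).symm
  · ext e
    exact sub_eq_zero.mpr
      (congrArg c (SimpleGraph.ConnectedComponent.eq.mpr (G.reachable e).symm))
  · intro c d hcd
    funext C
    induction C using SimpleGraph.ConnectedComponent.ind with
    | _ v => exact congrFun (congrArg Subtype.val hcd) v
  · rintro ⟨c, hc⟩
    exact ⟨fun C => C.lift c fun v w p _ => hF.eq_of_mem_ker hc ⟨p⟩, rfl⟩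

/-- By counting: the image has $|A|^{|V|} / |A|^{p_0} = |A|^{|F|}$ elements, because $|V| = |F| +
p_0$. This is where the absence of undirected cycles in the forest matters. -/
theorem IsSpanningForest.coboundary_surjective {V E A : Type*} [Finite V] [Finite E] [Finite A]
    [AddCommGroup A] {G : LoopyDigraph V E} {F : Set E} (hF : G.IsSpanningForest F) :
    Function.Surjective ((G.spanning F).coboundary A) := by
  refine AddMonoidHom.surjective_of_card_ker_le_div _ ?_
  rw [hF.card_ker_coboundary, Nat.card_fun, Nat.card_fun, ← hF.card_add_numComponents, pow_add,
    Nat.mul_div_cancel_left _ (pow_pos Nat.card_pos _)]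

/-! ### Counting flowing colourings -/

/-- For two edges with a common end, their other ends have the same colour exactly when the two
differences agree. The colour set is `Fin (n + 1)` so that it is a cyclic group. -/
theorem isFlowing_iff_coboundary {V E : Type*} {G : LoopyDigraph V E} {n : ℕ}
    (c : V → Fin (n + 1)) :
    G.IsFlowing c ↔ (∀ e, G.coboundary (Fin (n + 1)) c e ≠ 0) ∧
      ∀ e f, G.src e = G.src f ∨ G.tgt e = G.tgt f →
        G.coboundary (Fin (n + 1)) c e = G.coboundary (Fin (n + 1)) c f := by
  have hval : ∀ e, G.coboundary (Fin (n + 1)) c e = c (G.tgt e) - c (G.src e) := fun _ => rfl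
  simp only [hval]
  constructor
  · rintro ⟨h1, h2, h3⟩
    refine ⟨fun e => sub_ne_zero.mpr (h1 e).symm, ?_⟩
    rintro e f (h | h)
    · rw [h, h3 e f h]
    · rw [h, h2 e f h]
  · rintro ⟨h1, h2⟩
    refine ⟨fun e => (sub_ne_zero.mp (h1 e)).symm, fun e f h => ?_, fun e f h => ?_⟩
    · have := h2 e f (Or.inr h)
      rw [h] at this
      exact sub_right_injective this
    · have := h2 e f (Or.inl h)
      rw [h] at this
      exact sub_left_injective this

/-- A nowhere-zero function that is constant on the classes of edges is a nowhere-zero function on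
the set of classes. -/
theorem IsMP.card_nowhereZero {V E A : Type*} [Finite E] [Finite A] [Zero A]
    {G : LoopyDigraph V E} (hG : G.IsMP) (hcyc : ¬ G.HasCoherentCycle) :
    Nat.card {d : E → A // (∀ e, d e ≠ 0) ∧
        ∀ e f, G.src e = G.src f ∨ G.tgt e = G.tgt f → d e = d f} =
      (Nat.card A - 1) ^ Nat.card (Quotient (hG.edgeSetoid hcyc)) := by
  classical
  have := Fintype.ofFinite A
  have hA : Nat.card A - 1 = Nat.card {a : A // a ≠ 0} := by
    rw [Nat.card_eq_fintype_card, Nat.card_eq_fintype_card, Fintype.card_subtype_compl]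
    simp
  rw [hA, ← Nat.card_fun]
  refine (Nat.card_eq_of_bijective
    (fun d : Quotient (hG.edgeSetoid hcyc) → {a : A // a ≠ 0} =>
      (⟨fun e => d (Quotient.mk _ e), fun e => (d _).2, fun e f h =>
        congrArg (fun q => (d q : A)) ((hG.mk_eq_mk_iff hcyc e f).mpr h)⟩ :
        {d : E → A // (∀ e, d e ≠ 0) ∧
        ∀ e f, G.src e = G.src f ∨ G.tgt e = G.tgt f → d e = d f})) ⟨?_, ?_⟩).symm
  · intro d d' h
    funext q
    induction q using Quotient.ind with
    | _ e => exact Subtype.ext (congrFun (congrArg Subtype.val h) e)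
  · rintro ⟨d, h1, h2⟩
    exact ⟨Quotient.lift (fun e => ⟨d e, h1 e⟩) fun e f h => Subtype.ext (h2 e f h), rfl⟩

/-- Colourings are sorted by coboundary. The admissible coboundaries are the nowhere-zero functions
on the edge classes of the forest, and the number of those classes is its rank. -/
theorem IsSpanningForest.numFlowing_succ {V E : Type*} [Finite V] [Finite E]
    {G : LoopyDigraph V E} (hG : G.IsMP) (hcyc : ¬ G.HasCoherentCycle) {F : Set E}
    (hF : G.IsSpanningForest F) (n : ℕ) :
    (G.spanning F).numFlowing (n + 1) =
      (n + 1) ^ G.numComponents * n ^ (G.spanning F).rank (hG.spanning F) := by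
  have hcycF := not_hasCoherentCycle_spanning hcyc F
  let D := {d : F → Fin (n + 1) // (∀ e, d e ≠ 0) ∧ ∀ e f,
    (G.spanning F).src e = (G.spanning F).src f ∨ (G.spanning F).tgt e = (G.spanning F).tgt f →
      d e = d f}
  let δ := (G.spanning F).coboundary (Fin (n + 1))
  let φ : {c : V → Fin (n + 1) // (G.spanning F).IsFlowing c} → D :=
    fun c => ⟨δ c.1, (isFlowing_iff_coboundary c.1).mp c.2⟩
  have hfib : ∀ d : D, Nat.card {c // φ c = d} = (n + 1) ^ G.numComponents := by
    intro d
    have h1 : {c // φ c = d} ≃ (δ ⁻¹' {d.1}) :=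
      { toFun := fun c => ⟨c.1.1, congrArg Subtype.val c.2⟩
        invFun := fun c => ⟨⟨c.1, (isFlowing_iff_coboundary c.1).mpr (by
          have : δ c.1 = d.1 := c.2
          change (∀ e, δ c.1 e ≠ 0) ∧ ∀ e f, _ → δ c.1 e = δ c.1 f
          rw [this]
          exact d.2)⟩, Subtype.ext c.2⟩
        left_inv := fun _ => rfl
        right_inv := fun _ => rfl }
    -- Every colouring with an admissible coboundary is flowing, so the fibre is a full coset of the
    -- kernel.
    rw [Nat.card_congr (h1.trans
      (AddMonoidHom.fiberEquivKerOfSurjective hF.coboundary_surjective d.1)),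
      hF.card_ker_coboundary, Nat.card_eq_fintype_card, Fintype.card_fin]
  have := Fintype.ofFinite D
  have hD : Nat.card D = n ^ (G.spanning F).rank (hG.spanning F) := by
    rw [(hG.spanning F).card_nowhereZero hcycF, (hG.spanning F).rank_eq_card_quotient hcycF]
    simp
  rw [numFlowing, Nat.card_congr (Equiv.sigmaFiberEquiv φ).symm, Nat.card_sigma,
    Finset.sum_congr rfl fun d _ => hfib d, Finset.sum_const, Finset.card_univ,
    ← Nat.card_eq_fintype_card, hD, smul_eq_mul, mul_comm]

end LoopyDigraph

/-! ### Comparison of the two sides -/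

theorem mainTheorem2 {V E : Type*} [Finite V] [Finite E] (G : LoopyDigraph V E) (hG : G.IsMP)
    (hcyc : ¬ G.HasCoherentCycle) (F : Set E) (hF : G.IsSpanningForest F)
    (hrank : (G.spanning F).rank (hG.spanning F) = G.rank hG) (k : ℕ) :
    (k : ℤ) ^ G.numComponents *
        MvPolynomial.eval ![1 - (k : ℤ), 0] (G.multipathMatroid hG).tuttePoly =
      (-1) ^ G.rank hG * ((G.spanning F).numFlowing k : ℤ) := by
  rw [hG.eval_tuttePoly hcyc]
  cases k with
  | succ n =>
    rw [hF.numFlowing_succ hG hcyc, hrank]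
    push_cast
    rw [show (1 : ℤ) - (n + 1) = -1 * n by ring, mul_pow]
    ring
  | zero =>
    -- With no colours there is no group to use. Without vertices both sides are $1$, by $0^0 = 1$
    -- and the empty colouring; with a vertex both are $0$, since $p_0 > 0$ and no colouring exists.
    rcases isEmpty_or_nonempty V with hV | ⟨⟨v⟩⟩
    · have hE : IsEmpty E := ⟨fun e => hV.false (G.src e)⟩
      have hC : G.numComponents = 0 := by
        have : IsEmpty G.underlying.ConnectedComponent :=
          ⟨fun C => C.nonempty_supp.elim fun v _ => hV.false v⟩
        exact Nat.card_of_isEmpty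
      have hr : G.rank hG = 0 := by
        rw [hG.rank_eq_card_quotient hcyc]
        exact Nat.card_of_isEmpty
      have hc : (G.spanning F).numFlowing 0 = 1 := by
        rw [LoopyDigraph.numFlowing, Nat.card_eq_one_iff_unique]
        exact ⟨⟨fun a b => Subtype.ext (Subsingleton.elim _ _)⟩,
          ⟨⟨hV.elim, fun e => hV.elim (G.src e), fun e => hV.elim (G.src e),
            fun e => hV.elim (G.src e)⟩⟩⟩
      simp [hC, hr, hc]
    · have hC : G.numComponents ≠ 0 :=
        (@Nat.card_pos _ ⟨G.underlying.connectedComponentMk v⟩ _).ne'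
      have hc : (G.spanning F).numFlowing 0 = 0 := by
        have : IsEmpty {c : V → Fin 0 // (G.spanning F).IsFlowing c} := ⟨fun c => (c.1 v).elim0⟩
        exact Nat.card_of_isEmpty
      simp [hC, hc]
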